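/- **Corollary (the class of metric sofic groups is $\sup$-axiomatizable).** Let $L=(d,\cdot,{}^{-1},1)$ be the continuous signature of metric groups, with the identity as continuity modulus of every symbol. A metric $L$-structure is a nonempty complete metric space $(M,d)$ with $d\le 1$, together with operations $\cdot$, ${}^{-1}$, $1$ on $M$ that are $\mathrm{id}$-continuous in each argument separately: if one argument is changed to a point at distance less than $\varepsilon$ from it, the value changes by less than $\varepsilon$. $L$-formulas are built from $0$, $1$ and the expressions $d(t_1,t_2)$, with $t_1,t_2$ terms, by means of $x/2$, $1-x$, $\max(x-y,0)$, $\min(x+y,1)$, $\min(x,y)$, $\max(x,y)$, $|x-y|$, $\sup_x$ and $\inf_x$; they take values in $[0,1]$. Let $\mathcal S$ be the class of *metric sofic groups*: all metric $L$-structures $G$ that are groups under $\cdot$, ${}^{-1}$, $1$ and that embed, by an isometric group homomorphism, as a closed subgroup into a metric ultraproduct of finite symmetric groups with Hamming metrics. Such an ultraproduct is given by a set $I$, an ultrafilter $U$ on $I$ and integers $n_i\ge 1$ $(i\in I)$; it is the quotient of $\prod_{i\in I}\mathrm{Sym}(n_i)$ obtained by identifying points at distance $0$ for $$d\big((\sigma_i),(\tau_i)\big)=\lim_{i\to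 U}\frac{|\{k\le n_i:\sigma_i(k)\ne\tau_i(k)\}|}{n_i}.$$ Let $Th^c_{\sup}(\mathcal S)$ be the set of all closed conditions $\sup_{x_1}\cdots\sup_{x_n}\varphi=0$, with $\varphi$ an $L$-formula without $\sup$ and $\inf$, that hold in every member of $\mathcal S$. Then $\mathcal S$ is axiomatized by $Th^c_{\sup}(\mathcal S)$: a metric $L$-structure $M$ belongs to $\mathcal S$ if and only if every condition in $Th^c_{\sup}(\mathcal S)$ holds in $M$. -/

import Mathlib

open Filter Topology

universe u

noncomputable section

namespace ContLogic

/-! ### Continuous signatures, metric structures, formulas -/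

/-- A (one-sorted) continuous signature: function and predicate symbols of each arity, each with
a continuity modulus. The metric symbol `d` is always present and is not listed. -/
structure Signature where
  Func : ℕ → Type
  Pred : ℕ → Type
  funcModulus : ∀ {n : ℕ}, Func n → ℝ → ℝ
  predModulus : ∀ {n : ℕ}, Pred n → ℝ → ℝ
  funcModulus_pos : ∀ {n : ℕ} (F : Func n) (ε : ℝ), 0 < ε → 0 < funcModulus F ε
  predModulus_pos : ∀ {n : ℕ} (R : Pred n) (ε : ℝ), 0 < ε → 0 < predModulus R ε

/-- A metric `L`-structure: a nonempty complete metric space with metric bounded by `1`, with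
interpretations of the symbols of `L` that respect the continuity moduli, one argument at a
time. -/
structure MetricStructure (L : Signature) where
  carrier : Type u
  [metric : MetricSpace carrier]
  [complete : CompleteSpace carrier]
  [nonempty : Nonempty carrier]
  dist_le_one : ∀ x y : carrier, dist x y ≤ 1
  func : ∀ {n : ℕ}, L.Func n → (Fin n → carrier) → carrier
  pred : ∀ {n : ℕ}, L.Pred n → (Fin n → carrier) → ℝ
  pred_mem : ∀ {n : ℕ} (R : L.Pred n) (x : Fin n → carrier), pred R x ∈ Set.Icc (0 : ℝ) 1
  func_continuous : ∀ {n : ℕ} (F : L.Func n) (ε : ℝ), 0 < ε →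
    ∀ (x : Fin n → carrier) (j : Fin n) (y : carrier), dist (x j) y < L.funcModulus F ε →
      dist (func F x) (func F (Function.update x j y)) < ε
  pred_continuous : ∀ {n : ℕ} (R : L.Pred n) (ε : ℝ), 0 < ε →
    ∀ (x : Fin n → carrier) (j : Fin n) (y : carrier), dist (x j) y < L.predModulus R ε →
      |pred R x - pred R (Function.update x j y)| < ε

attribute [instance] MetricStructure.metric MetricStructure.complete MetricStructure.nonempty

/-- `L`-terms in the variables `x_0, …, x_{n-1}`. -/
inductive Term (L : Signature) (n : ℕ) : Type
  | var : Fin n → Term L n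
  | app : ∀ {k : ℕ}, L.Func k → (Fin k → Term L n) → Term L n

/-- `L`-formulas with free variables among `x_0, …, x_{n-1}`; the quantifiers `sup` and `inf`
bind the last variable. -/
inductive Formula (L : Signature) : ℕ → Type
  | zero : ∀ {n : ℕ}, Formula L n
  | one : ∀ {n : ℕ}, Formula L n
  | dist : ∀ {n : ℕ}, Term L n → Term L n → Formula L n
  | pred : ∀ {n k : ℕ}, L.Pred k → (Fin k → Term L n) → Formula L n
  | half : ∀ {n : ℕ}, Formula L n → Formula L n
  | neg : ∀ {n : ℕ}, Formula L n → Formula L n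
  | dotMinus : ∀ {n : ℕ}, Formula L n → Formula L n → Formula L n
  | dotPlus : ∀ {n : ℕ}, Formula L n → Formula L n → Formula L n
  | min : ∀ {n : ℕ}, Formula L n → Formula L n → Formula L n
  | max : ∀ {n : ℕ}, Formula L n → Formula L n → Formula L n
  | absDiff : ∀ {n : ℕ}, Formula L n → Formula L n → Formula L n
  | sup : ∀ {n : ℕ}, Formula L (n + 1) → Formula L n
  | inf : ∀ {n : ℕ}, Formula L (n + 1) → Formula L n

/-- Formulas without free variables. -/
abbrev Sentence (L : Signature) : Type := Formula L 0

variable {L : Signature}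

/-- The value of a term in a metric structure. -/
def Term.val (M : MetricStructure.{u} L) {n : ℕ} (v : Fin n → M.carrier) : Term L n → M.carrier
  | .var i => v i
  | .app F t => M.func F fun j => (t j).val M v

/-- The value of a formula in a metric structure, a real number in `[0,1]`
(see `Formula.val_mem`). -/
def Formula.val (M : MetricStructure.{u} L) :
    {n : ℕ} → Formula L n → (Fin n → M.carrier) → ℝ
  | _, .zero, _ => 0
  | _, .one, _ => 1
  | _, .dist s t, v => Dist.dist (s.val M v) (t.val M v)
  | _, .pred R t, v => M.pred R fun j => (t j).val M v
  | _, .half φ, v => φ.val M v / 2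
  | _, .neg φ, v => 1 - φ.val M v
  | _, .dotMinus φ ψ, v => Max.max (φ.val M v - ψ.val M v) 0
  | _, .dotPlus φ ψ, v => Min.min (φ.val M v + ψ.val M v) 1
  | _, .min φ ψ, v => Min.min (φ.val M v) (ψ.val M v)
  | _, .max φ ψ, v => Max.max (φ.val M v) (ψ.val M v)
  | _, .absDiff φ ψ, v => |φ.val M v - ψ.val M v|
  | _, .sup φ, v => ⨆ a : M.carrier, φ.val M (Fin.snoc (α := fun _ => M.carrier) v a)
  | _, .inf φ, v => ⨅ a : M.carrier, φ.val M (Fin.snoc (α := fun _ => M.carrier) v a)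

theorem Formula.val_mem (M : MetricStructure.{u} L) {n : ℕ} (φ : Formula L n)
    (v : Fin n → M.carrier) : φ.val M v ∈ Set.Icc (0 : ℝ) 1 := by
  induction φ with
  | zero => simp [Formula.val]
  | one => simp [Formula.val]
  | dist s t => exact ⟨dist_nonneg, M.dist_le_one _ _⟩
  | pred R t => exact M.pred_mem _ _
  | half φ ih =>
    have := ih v
    simp only [Formula.val, Set.mem_Icc] at *
    constructor <;> linarith
  | neg φ ih =>
    have := ih v
    simp only [Formula.val, Set.mem_Icc] at *
    constructor <;> linarith
  | dotMinus φ ψ ih1 ih2 =>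
    have h1 := ih1 v
    have h2 := ih2 v
    simp only [Formula.val, Set.mem_Icc] at *
    exact ⟨le_max_right _ _, max_le (by linarith) zero_le_one⟩
  | dotPlus φ ψ ih1 ih2 =>
    have h1 := ih1 v
    have h2 := ih2 v
    simp only [Formula.val, Set.mem_Icc] at *
    exact ⟨le_min (by linarith) zero_le_one, min_le_right _ _⟩
  | min φ ψ ih1 ih2 =>
    have h1 := ih1 v
    have h2 := ih2 v
    exact ⟨le_min h1.1 h2.1, (min_le_left _ _).trans h1.2⟩
  | max φ ψ ih1 ih2 =>
    have h1 := ih1 v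
    have h2 := ih2 v
    exact ⟨h1.1.trans (le_max_left _ _), max_le h1.2 h2.2⟩
  | absDiff φ ψ ih1 ih2 =>
    have h1 := ih1 v
    have h2 := ih2 v
    simp only [Formula.val, Set.mem_Icc] at *
    exact ⟨abs_nonneg _, abs_le.2 ⟨by linarith, by linarith⟩⟩
  | sup φ ih =>
    exact ⟨Real.iSup_nonneg fun a => (ih _).1, ciSup_le fun a => (ih _).2⟩
  | inf φ ih =>
    refine ⟨Real.iInf_nonneg fun a => (ih _).1, ?_⟩
    obtain ⟨a⟩ := M.nonempty
    exact (ciInf_le ⟨0, by rintro _ ⟨b, rfl⟩; exact (ih _).1⟩ a).trans (ih _).2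

/-- A formula that contains neither `sup` nor `inf`. -/
def Formula.IsQuantifierFree : {n : ℕ} → Formula L n → Prop
  | _, .zero => True
  | _, .one => True
  | _, .dist _ _ => True
  | _, .pred _ _ => True
  | _, .half φ => φ.IsQuantifierFree
  | _, .neg φ => φ.IsQuantifierFree
  | _, .dotMinus φ ψ => φ.IsQuantifierFree ∧ ψ.IsQuantifierFree
  | _, .dotPlus φ ψ => φ.IsQuantifierFree ∧ ψ.IsQuantifierFree
  | _, .min φ ψ => φ.IsQuantifierFree ∧ ψ.IsQuantifierFree
  | _, .max φ ψ => φ.IsQuantifierFree ∧ ψ.IsQuantifierFree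
  | _, .absDiff φ ψ => φ.IsQuantifierFree ∧ ψ.IsQuantifierFree
  | _, .sup _ => False
  | _, .inf _ => False

/-- The sentence `sup_{x_0} ⋯ sup_{x_{n-1}} φ`. -/
def Formula.supAll : {n : ℕ} → Formula L n → Sentence L
  | 0, φ => φ
  | _ + 1, φ => φ.sup.supAll

/-- The closed condition `φ = 0` holds in `M`. -/
def MetricStructure.Satisfies (M : MetricStructure.{u} L) (φ : Sentence L) : Prop :=
  φ.val M Fin.elim0 = 0

/-- `M` is a model of the theory consisting of the conditions `φ = 0`, `φ ∈ T`. -/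
def MetricStructure.IsModel (M : MetricStructure.{u} L) (T : Set (Sentence L)) : Prop :=
  ∀ φ ∈ T, M.Satisfies φ

/-- The sup-theory of a class of metric structures: the sentences
`σ = sup_{x_0} ⋯ sup_{x_{n-1}} φ`, with `φ` free of quantifiers, such that `σ = 0` holds in every
structure of the class. -/
def supTheory (C : MetricStructure.{u} L → Prop) : Set (Sentence L) :=
  {σ | (∃ (n : ℕ) (φ : Formula L n), φ.IsQuantifierFree ∧ σ = φ.supAll) ∧
    ∀ M, C M → M.Satisfies σ}

/-- The class `C` is axiomatized by its sup-theory. -/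
def IsSupAxiomatizable (C : MetricStructure.{u} L → Prop) : Prop :=
  ∀ M : MetricStructure.{u} L, C M ↔ M.IsModel (supTheory C)

/-! ### The signature of metric groups -/

/-- The symbols `1`, `⁻¹`, `·`. -/
inductive GroupFunc : ℕ → Type
  | one : GroupFunc 0
  | inv : GroupFunc 1
  | mul : GroupFunc 2

/-- The signature `(d, ·, ⁻¹, 1)` of metric groups; all continuity moduli are the identity. -/
def groupSignature : Signature where
  Func := GroupFunc
  Pred := fun _ => Empty
  funcModulus := fun _ => id
  predModulus := fun _ => id
  funcModulus_pos := fun _ _ h => h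
  predModulus_pos := fun _ _ h => h

/-! ### Metric ultraproducts of finite symmetric groups -/

/-- The normalized Hamming distance on `Sym(n)`. -/
def permDist {n : ℕ} (σ τ : Equiv.Perm (Fin n)) : ℝ := (hammingDist (⇑σ) (⇑τ) : ℝ) / n

theorem permDist_nonneg {n : ℕ} (σ τ : Equiv.Perm (Fin n)) : 0 ≤ permDist σ τ := by
  unfold permDist; positivity

theorem permDist_le_one {n : ℕ} (σ τ : Equiv.Perm (Fin n)) : permDist σ τ ≤ 1 := by
  unfold permDist
  refine div_le_one_of_le₀ ?_ (Nat.cast_nonneg n)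
  have := hammingDist_le_card_fintype (x := (⇑σ)) (y := (⇑τ))
  simp only [Fintype.card_fin] at this
  exact_mod_cast this

theorem permDist_self {n : ℕ} (σ : Equiv.Perm (Fin n)) : permDist σ σ = 0 := by
  simp [permDist]

theorem permDist_comm {n : ℕ} (σ τ : Equiv.Perm (Fin n)) : permDist σ τ = permDist τ σ := by
  simp [permDist, hammingDist_comm]

theorem permDist_triangle {n : ℕ} (σ τ ρ : Equiv.Perm (Fin n)) :
    permDist σ ρ ≤ permDist σ τ + permDist τ ρ := by
  unfold permDist
  rw [← add_div]
  gcongr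
  exact_mod_cast hammingDist_triangle _ _ _

theorem permDist_mul_left {n : ℕ} (ρ σ τ : Equiv.Perm (Fin n)) :
    permDist (ρ * σ) (ρ * τ) = permDist σ τ := by
  unfold permDist
  congr 2
  exact hammingDist_comp (fun _ => ρ) (fun _ => ρ.injective)

theorem permDist_mul_right {n : ℕ} (ρ σ τ : Equiv.Perm (Fin n)) :
    permDist (σ * ρ) (τ * ρ) = permDist σ τ := by
  unfold permDist hammingDist
  congr 2
  refine Finset.card_equiv ρ fun i => ?_
  rw [Finset.mem_filter, Finset.mem_filter]
  simp

theorem permDist_inv {n : ℕ} (σ τ : Equiv.Perm (Fin n)) :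
    permDist σ⁻¹ τ⁻¹ = permDist σ τ := by
  rw [← permDist_mul_left σ, ← permDist_mul_right τ]
  simp [permDist_comm]

variable {I : Type u}

/-- The product `∏ i, Sym(n i)`, to be given the pseudometric `lim_U d_i`. -/
def PermProduct (_ : Ultrafilter I) (n : I → ℕ) : Type u := ∀ i, Equiv.Perm (Fin (n i))

namespace PermProduct

variable {U : Ultrafilter I} {n : I → ℕ}

instance : Group (PermProduct U n) :=
  inferInstanceAs (Group (∀ i, Equiv.Perm (Fin (n i))))

instance : Dist (PermProduct U n) where
  dist x y := limUnder (U : Filter I) fun i => permDist (x i) (y i)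

theorem dist_def (x y : PermProduct U n) :
    dist x y = limUnder (U : Filter I) fun i => permDist (x i) (y i) := rfl

/-- The ultralimit that defines the distance exists. -/
theorem tendsto_dist (x y : PermProduct U n) :
    Tendsto (fun i => permDist (x i) (y i)) U (𝓝 (dist x y)) := by
  have h : ∀ i, permDist (x i) (y i) ∈ Set.Icc (0 : ℝ) 1 :=
    fun i => ⟨permDist_nonneg _ _, permDist_le_one _ _⟩
  obtain ⟨r, -, hr⟩ := isCompact_Icc.ultrafilter_le_nhds
    (U.map fun i => permDist (x i) (y i))
    (le_principal_iff.2 (Filter.mem_map.2 (Filter.univ_mem' h)))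
  exact tendsto_nhds_limUnder ⟨r, hr⟩

instance : PseudoMetricSpace (PermProduct U n) where
  dist_self x := by simp [dist_def, permDist_self, tendsto_const_nhds.limUnder_eq]
  dist_comm x y := by simp [dist_def, permDist_comm]
  dist_triangle x y z :=
    le_of_tendsto_of_tendsto' (tendsto_dist x z) ((tendsto_dist x y).add (tendsto_dist y z))
      fun _ => permDist_triangle _ _ _

theorem dist_mul_left (z x y : PermProduct U n) : dist (z * x) (z * y) = dist x y := by
  rw [dist_def, dist_def]
  congr 1
  funext i
  exact permDist_mul_left _ _ _

theorem dist_mul_right (z x y : PermProduct U n) : dist (x * z) (y * z) = dist x y := by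
  rw [dist_def, dist_def]
  congr 1
  funext i
  exact permDist_mul_right _ _ _

theorem dist_inv (x y : PermProduct U n) : dist x⁻¹ y⁻¹ = dist x y := by
  rw [dist_def, dist_def]
  congr 1
  funext i
  exact permDist_inv _ _

instance : IsTopologicalGroup (PermProduct U n) where
  continuous_mul := by
    refine (LipschitzWith.of_dist_le_mul (K := 2) fun p q => ?_).continuous
    calc dist (p.1 * p.2) (q.1 * q.2)
        ≤ dist (p.1 * p.2) (p.1 * q.2) + dist (p.1 * q.2) (q.1 * q.2) := dist_triangle _ _ _
      _ = dist p.2 q.2 + dist p.1 q.1 := by rw [dist_mul_left, dist_mul_right]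
      _ ≤ dist p q + dist p q := add_le_add (le_max_right _ _) (le_max_left _ _)
      _ = (2 : NNReal) * dist p q := by push_cast; ring
  continuous_inv := (Isometry.of_dist_eq dist_inv).continuous

end PermProduct

/-- The metric ultraproduct of the symmetric groups `Sym(n i)` with normalized Hamming metrics:
the quotient of `∏ i, Sym(n i)` that identifies points at distance `lim_U d_i = 0`. -/
abbrev MetricUltraproduct (U : Ultrafilter I) (n : I → ℕ) : Type u :=
  SeparationQuotient (PermProduct U n)


/-! ### Metric sofic groups -/

/-- The metric structure `M` is a group (with the interpretations of `·`, `⁻¹`, `1` as its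
operations) that is isometrically isomorphic to a closed subgroup of a metric ultraproduct of
finite symmetric groups with Hamming metrics. That `M` is complete, of diameter at most `1` and
`id`-continuous is part of its being a metric structure of the signature. -/
def IsMetricSofic (M : MetricStructure.{u} groupSignature) : Prop :=
  ∃ _ : Group M.carrier,
    (∀ x y : M.carrier, M.func GroupFunc.mul ![x, y] = x * y) ∧
    (∀ x : M.carrier, M.func GroupFunc.inv ![x] = x⁻¹) ∧
    M.func GroupFunc.one ![] = 1 ∧
    ∃ (I : Type u) (U : Ultrafilter I) (n : I → ℕ) (f : M.carrier →* MetricUltraproduct U n),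
      (∀ i, 0 < n i) ∧ Isometry f ∧ IsClosed (Set.range f)

end ContLogic

end

/-!
A class is contained in the models of its sup-theory by definition, so the content is that a model
`M` of the sup-theory of the metric sofic groups is metric sofic.

Let `C` be any class of metric structures and `M` a model of its sup-theory. If `a` is a tuple in
`M`, then the values at `a` of finitely many quantifier-free formulas `φ₁, …, φₖ` can be approximated
by their values at a tuple of some member of `C`: choose dyadic constants `qᵢ` close to
`φᵢ(a)`, put `ψ = maxᵢ |φᵢ - qᵢ|`, and observe that for a suitable dyadic `q` the formula
`max(q - ψ, 0)` does not vanish at `a`, hence does not vanish identically on `C`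
(`MetricStructure.IsModel.exists_forall_abs_sub_lt`).

For the metric sofic groups this has two consequences. The group axioms are equations between
terms, so `M` is a group. Every finite part of the multiplication and distance table
of `M` is approximated in a metric sofic group, hence in a metric ultraproduct of
symmetric groups, and hence in a single `Sym(n)` (`exists_perm_approx`). An ultrafilter on pairs
(finite subset of `M`, precision) refining the order at infinity glues these approximations to an
isometric homomorphism from `M` into a metric ultraproduct. Its range is closed because `M` is
complete.
-/

namespace ContLogic

/-! ### Sup-sentences and constants -/

section General

variable {L : Signature}

theorem Formula.satisfies_supAll_iff (M : MetricStructure.{u} L) {n : ℕ} (φ : Formula L n) :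
    M.Satisfies φ.supAll ↔ ∀ v, φ.val M v = 0 := by
  induction n with
  | zero =>
    refine ⟨fun h v => ?_, fun h => h _⟩
    rw [Subsingleton.elim v Fin.elim0]
    exact h
  | succ n ih =>
    refine (ih φ.sup).trans ⟨fun h v => ?_, fun h v => ?_⟩
    · refine le_antisymm ?_ (φ.val_mem M v).1
      rw [← h (Fin.init v)]
      have hb : BddAbove (Set.range fun a : M.carrier =>
          φ.val M (Fin.snoc (α := fun _ => M.carrier) (Fin.init v) a)) :=
        ⟨1, by rintro _ ⟨a, rfl⟩; exact (φ.val_mem M _).2⟩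
      have := le_ciSup hb (v (Fin.last n))
      rwa [Fin.snoc_init_self] at this
    · simp [Formula.val, h]

/-- Dyadic numbers, which are the values of constant formulas, are dense in `[0,1]`. -/
theorem Formula.exists_const (n : ℕ) {r ε : ℝ} (hr : r ∈ Set.Icc (0 : ℝ) 1) (hε : 0 < ε) :
    ∃ (q : ℝ) (c : Formula L n), |q - r| < ε ∧ c.IsQuantifierFree ∧
      ∀ (M : MetricStructure.{u} L) v, c.val M v = q := by
  obtain ⟨k, hk⟩ := exists_pow_lt_of_lt_one hε (by norm_num : (1 / 2 : ℝ) < 1)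
  suffices H : ∃ (q : ℝ) (c : Formula L n), |q - r| ≤ (1 / 2) ^ k ∧ c.IsQuantifierFree ∧
      ∀ (M : MetricStructure.{u} L) v, c.val M v = q by
    obtain ⟨q, c, h, h'⟩ := H
    exact ⟨q, c, h.trans_lt hk, h'⟩
  clear hk
  induction k generalizing r with
  | zero =>
    refine ⟨0, .zero, ?_, trivial, fun _ _ => rfl⟩
    rw [abs_le, pow_zero]
    constructor <;> linarith [hr.1, hr.2]
  | succ k ih =>
    -- `x ↦ x / 2` and `x ↦ 1 - x / 2` map `[0,1]` onto its two halves and halve distances.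
    rcases le_total r (1 / 2) with h | h
    · obtain ⟨q, c, hq, hc, hv⟩ := ih (r := 2 * r) ⟨by linarith [hr.1], by linarith⟩
      refine ⟨q / 2, .half c, ?_, hc, fun M v => by rw [Formula.val, hv]⟩
      rw [abs_le] at hq ⊢
      rw [pow_succ]
      constructor <;> linarith
    · obtain ⟨q, c, hq, hc, hv⟩ := ih (r := 2 * (1 - r)) ⟨by linarith [hr.2], by linarith⟩
      refine ⟨1 - q / 2, .neg (.half c), ?_, hc, fun M v => by rw [Formula.val, Formula.val, hv]⟩
      rw [abs_le] at hq ⊢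
      rw [pow_succ]
      constructor <;> linarith

theorem Formula.exists_listMax {n : ℕ} (l : List (Formula L n))
    (hl : ∀ φ ∈ l, φ.IsQuantifierFree) :
    ∃ ψ : Formula L n, ψ.IsQuantifierFree ∧ ∀ (M : MetricStructure.{u} L) v (r : ℝ), 0 < r →
      (ψ.val M v < r ↔ ∀ φ ∈ l, φ.val M v < r) := by
  induction l with
  | nil => exact ⟨.zero, trivial, fun M v r hr => by simpa [Formula.val] using hr⟩
  | cons φ l ih =>
    obtain ⟨ψ, hψ, h⟩ := ih fun φ hφ => hl φ (List.mem_cons_of_mem _ hφ)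
    refine ⟨.max φ ψ, ⟨hl φ List.mem_cons_self, hψ⟩, fun M v r hr => ?_⟩
    rw [Formula.val, max_lt_iff, h M v r hr, List.forall_mem_cons]

/-! ### Approximation of a model of the sup-theory -/

variable {C : MetricStructure.{u} L → Prop} {M : MetricStructure.{u} L}

theorem MetricStructure.IsModel.exists_val_ne_zero (hM : M.IsModel (supTheory C)) {n : ℕ}
    {φ : Formula L n} (hφ : φ.IsQuantifierFree) {a : Fin n → M.carrier} (ha : φ.val M a ≠ 0) :
    ∃ N, C N ∧ ∃ b, φ.val N b ≠ 0 := by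
  by_contra! h
  exact ha ((φ.satisfies_supAll_iff M).1 (hM _ ⟨⟨n, φ, hφ, rfl⟩,
    fun N hN => (φ.satisfies_supAll_iff N).2 (h N hN)⟩) a)

theorem MetricStructure.IsModel.exists_val_lt (hM : M.IsModel (supTheory C)) {n : ℕ}
    {ψ : Formula L n} (hψ : ψ.IsQuantifierFree) {a : Fin n → M.carrier} {r : ℝ}
    (hr : r ≤ 1) (ha : ψ.val M a < r) : ∃ N, C N ∧ ∃ b, ψ.val N b < r := by
  have h0 := (ψ.val_mem M a).1
  -- A dyadic `q` strictly between `ψ(a)` and `r`.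
  obtain ⟨q, c, hq, hc, hv⟩ := Formula.exists_const.{u} (L := L) n
    (r := (ψ.val M a + r) / 2) (ε := (r - ψ.val M a) / 2)
    ⟨by linarith, by linarith⟩ (by linarith)
  rw [abs_lt] at hq
  obtain ⟨N, hN, b, hb⟩ := hM.exists_val_ne_zero (φ := .dotMinus c ψ) ⟨hc, hψ⟩ (a := a) <| by
    rw [Formula.val, hv]
    exact (lt_max_of_lt_left (by linarith)).ne'
  refine ⟨N, hN, b, ?_⟩
  rw [Formula.val, hv] at hb
  by_contra! h
  exact hb (max_eq_right (by linarith))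

/-- In a model of the sup-theory of `C`, the values of finitely many quantifier-free formulas at a
tuple are approximated by their values at a tuple of a member of `C`. -/
theorem MetricStructure.IsModel.exists_forall_abs_sub_lt (hM : M.IsModel (supTheory C)) {n : ℕ}
    {ι : Type*} [Finite ι] (φ : ι → Formula L n) (hφ : ∀ i, (φ i).IsQuantifierFree)
    (a : Fin n → M.carrier) {ε : ℝ} (hε : 0 < ε) :
    ∃ N, C N ∧ ∃ b, ∀ i, |(φ i).val N b - (φ i).val M a| < ε := by
  have := Fintype.ofFinite ι
  set δ : ℝ := min (ε / 2) 1
  have hδ : 0 < δ := lt_min (by linarith) one_pos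
  have hδε : δ ≤ ε / 2 := min_le_left _ _
  choose q c hq hc hv using fun i =>
    Formula.exists_const.{u} (L := L) n ((φ i).val_mem M a) hδ
  obtain ⟨ψ, hψ, h⟩ := Formula.exists_listMax.{u}
    (Finset.univ.toList.map fun i => Formula.absDiff (φ i) (c i)) (by
      simpa using fun i => ⟨hφ i, hc i⟩)
  obtain ⟨N, hN, b, hb⟩ := hM.exists_val_lt hψ (a := a) (min_le_right _ _ : δ ≤ 1) <| by
    rw [h M a δ hδ]
    simpa [Formula.val, hv, abs_sub_comm] using hq
  refine ⟨N, hN, b, fun i => ?_⟩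
  rw [h N b δ hδ] at hb
  have h1 : |(φ i).val N b - q i| < δ := by
    have := hb _ (List.mem_map_of_mem (Finset.mem_toList.2 (Finset.mem_univ i)))
    rwa [Formula.val, hv] at this
  calc |(φ i).val N b - (φ i).val M a|
      ≤ |(φ i).val N b - q i| + |q i - (φ i).val M a| := abs_sub_le _ _ _
    _ < ε := by linarith [hq i]

/-- An equation between terms that is valid in all members of `C` is valid in all models of the
sup-theory of `C`. -/
theorem MetricStructure.IsModel.val_eq_val (hM : M.IsModel (supTheory C)) {n : ℕ}
    {s t : Term L n} (h : ∀ N, C N → ∀ b, s.val N b = t.val N b) (a : Fin n → M.carrier) :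
    s.val M a = t.val M a := by
  by_contra hne
  obtain ⟨N, hN, b, hb⟩ := hM.exists_val_ne_zero (φ := .dist s t) trivial (a := a)
    (dist_ne_zero.2 hne)
  exact hb (dist_eq_zero.2 (h N hN b))

end General

/-! ### Terms in the signature of metric groups -/

/-- The term `1`. -/
def oneTerm {n : ℕ} : Term groupSignature n := .app (L := groupSignature) GroupFunc.one ![]

/-- The term `t⁻¹`. -/
def invTerm {n : ℕ} (t : Term groupSignature n) : Term groupSignature n :=
  .app (L := groupSignature) GroupFunc.inv ![t]

/-- The term `s · t`. -/
def mulTerm {n : ℕ} (s t : Term groupSignature n) : Term groupSignature n :=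
  .app (L := groupSignature) GroupFunc.mul ![s, t]

section Terms

variable (M : MetricStructure.{u} groupSignature) {n : ℕ} (v : Fin n → M.carrier)

theorem val_oneTerm : oneTerm.val M v = M.func GroupFunc.one ![] := by
  exact congrArg (M.func (L := groupSignature) GroupFunc.one) (Subsingleton.elim _ _)

theorem val_invTerm (t : Term groupSignature n) :
    (invTerm t).val M v = M.func GroupFunc.inv ![t.val M v] := by
  refine congrArg (M.func (L := groupSignature) GroupFunc.inv) (funext fun j => ?_)
  fin_cases j
  rfl

theorem val_mulTerm (s t : Term groupSignature n) :
    (mulTerm s t).val M v = M.func GroupFunc.mul ![s.val M v, t.val M v] := by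
  refine congrArg (M.func (L := groupSignature) GroupFunc.mul) (funext fun j => ?_)
  fin_cases j <;> rfl

end Terms

/-! ### Models of the sup-theory of the metric sofic groups -/

variable {M : MetricStructure.{u} groupSignature}

/-- The group operations on a model of the sup-theory of the metric sofic groups. -/
abbrev groupOfIsModel (hM : M.IsModel (supTheory IsMetricSofic.{u})) : Group M.carrier :=
  letI : Mul M.carrier := ⟨fun x y => M.func GroupFunc.mul ![x, y]⟩
  letI : Inv M.carrier := ⟨fun x => M.func GroupFunc.inv ![x]⟩
  letI : One M.carrier := ⟨M.func GroupFunc.one ![]⟩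
  Group.ofLeftAxioms
    (fun x y z => by
      have := hM.val_eq_val (s := mulTerm (mulTerm (.var 0) (.var 1)) (.var 2))
        (t := mulTerm (.var 0) (mulTerm (.var 1) (.var 2)))
        (fun N ⟨_, hmul, _⟩ b => by simp only [val_mulTerm, hmul, mul_assoc]) ![x, y, z]
      simp only [val_mulTerm, Term.val] at this
      exact this)
    (fun x => by
      have := hM.val_eq_val (s := mulTerm oneTerm (.var 0)) (t := .var 0)
        (fun N ⟨_, hmul, _, hone, _⟩ b => by
          simp only [val_mulTerm, val_oneTerm, hmul, hone, one_mul]) ![x]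
      simp only [val_mulTerm, val_oneTerm, Term.val] at this
      exact this)
    (fun x => by
      have := hM.val_eq_val (s := mulTerm (invTerm (.var 0)) (.var 0)) (t := oneTerm)
        (fun N ⟨_, hmul, hinv, hone, _⟩ b => by
          simp only [val_mulTerm, val_invTerm, val_oneTerm, hmul, hinv, hone, inv_mul_cancel])
        ![x]
      simp only [val_mulTerm, val_invTerm, val_oneTerm, Term.val] at this
      exact this)

/-- Finitely many distances between elements, and between products and elements, of a
metric sofic group are approximated by those of permutations in a single symmetric group. -/
theorem IsMetricSofic.exists_perm_approx {N : MetricStructure.{u} groupSignature}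
    (hN : IsMetricSofic N) {m : ℕ} (b : Fin m → N.carrier) {ε : ℝ} (hε : 0 < ε) :
    ∃ n : ℕ, 0 < n ∧ ∃ σ : Fin m → Equiv.Perm (Fin n),
      (∀ i j, |permDist (σ i) (σ j) - dist (b i) (b j)| < ε) ∧
      ∀ i j k, |permDist (σ i * σ j) (σ k) - dist (N.func GroupFunc.mul ![b i, b j]) (b k)| < ε := by
  obtain ⟨_, hmul, -, -, I, U, n, f, hn, hf, -⟩ := hN
  choose s hs using fun i => SeparationQuotient.surjective_mk (f (b i))
  have h1 : ∀ i j, ∀ᶠ t in (U : Filter I),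
      |permDist (s i t) (s j t) - dist (b i) (b j)| < ε := fun i j => by
    have h := PermProduct.tendsto_dist (s i) (s j)
    rw [← SeparationQuotient.dist_mk, hs, hs, hf.dist_eq] at h
    exact Metric.tendsto_nhds.1 h ε hε
  have h2 : ∀ i j k, ∀ᶠ t in (U : Filter I),
      |permDist (s i t * s j t) (s k t) - dist (N.func GroupFunc.mul ![b i, b j]) (b k)| < ε :=
    fun i j k => by
      have h := PermProduct.tendsto_dist (s i * s j) (s k)
      rw [← SeparationQuotient.dist_mk, SeparationQuotient.mk_mul, hs, hs, hs, ← map_mul,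
        hf.dist_eq, ← hmul] at h
      exact Metric.tendsto_nhds.1 h ε hε
  obtain ⟨t, ht1, ht2⟩ := ((eventually_all.2 fun i => eventually_all.2 (h1 i)).and
    (eventually_all.2 fun i => eventually_all.2 fun j => eventually_all.2 (h2 i j))).exists
  exact ⟨n t, hn t, fun i => s i t, ht1, ht2⟩

/-- A finite part of the multiplication and distance table of a model of the sup-theory of
the metric sofic groups is approximated in a symmetric group. -/
theorem exists_perm_approx (hM : M.IsModel (supTheory IsMetricSofic.{u})) (F : Finset M.carrier)
    {ε : ℝ} (hε : 0 < ε) :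
    ∃ n : ℕ, 0 < n ∧ ∃ g : M.carrier → Equiv.Perm (Fin n),
      (∀ x ∈ F, ∀ y ∈ F, |permDist (g x) (g y) - dist x y| < ε) ∧
      ∀ x ∈ F, ∀ y ∈ F, ∀ z ∈ F,
        |permDist (g x * g y) (g z) - dist (M.func GroupFunc.mul ![x, y]) z| < ε := by
  classical
  let e := F.equivFin
  let a : Fin F.card → M.carrier := fun i => e.symm i
  let φ : (Fin F.card × Fin F.card) ⊕ (Fin F.card × Fin F.card × Fin F.card) →
      Formula groupSignature F.card :=
    Sum.elim (fun p => .dist (.var p.1) (.var p.2))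
      fun p => .dist (mulTerm (.var p.1) (.var p.2.1)) (.var p.2.2)
  obtain ⟨N, hN, b, hb⟩ := hM.exists_forall_abs_sub_lt φ
    (by rintro (p | p) <;> trivial) a (half_pos hε)
  obtain ⟨n, hn, σ, h1, h2⟩ := hN.exists_perm_approx b (half_pos hε)
  have hg : ∀ x (hx : x ∈ F), a (e ⟨x, hx⟩) = x := fun x hx => by simp [a]
  refine ⟨n, hn, fun x => if hx : x ∈ F then σ (e ⟨x, hx⟩) else 1, fun x hx y hy => ?_,
    fun x hx y hy z hz => ?_⟩
  · simp only [dif_pos hx, dif_pos hy]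
    have hb' := hb (.inl (e ⟨x, hx⟩, e ⟨y, hy⟩))
    simp only [φ, Sum.elim_inl, Formula.val, Term.val, hg] at hb'
    linarith [abs_sub_le (permDist (σ (e ⟨x, hx⟩)) (σ (e ⟨y, hy⟩)))
      (dist (b (e ⟨x, hx⟩)) (b (e ⟨y, hy⟩))) (dist x y), h1 (e ⟨x, hx⟩) (e ⟨y, hy⟩)]
  · simp only [dif_pos hx, dif_pos hy, dif_pos hz]
    have hb' := hb (.inr (e ⟨x, hx⟩, e ⟨y, hy⟩, e ⟨z, hz⟩))
    simp only [φ, Sum.elim_inr, Formula.val, val_mulTerm, Term.val, hg] at hb'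
    linarith [abs_sub_le (permDist (σ (e ⟨x, hx⟩) * σ (e ⟨y, hy⟩)) (σ (e ⟨z, hz⟩)))
      (dist (N.func GroupFunc.mul ![b (e ⟨x, hx⟩), b (e ⟨y, hy⟩)]) (b (e ⟨z, hz⟩)))
      (dist (M.func GroupFunc.mul ![x, y]) z), h2 (e ⟨x, hx⟩) (e ⟨y, hy⟩) (e ⟨z, hz⟩)]

theorem isMetricSofic_of_isModel (hM : M.IsModel (supTheory IsMetricSofic.{u})) :
    IsMetricSofic M := by
  let := groupOfIsModel hM
  refine ⟨groupOfIsModel hM, fun _ _ => rfl, fun _ => rfl, rfl, ?_⟩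
  let I := Finset M.carrier × ℕ
  choose n hn g hg1 hg2 using fun i : I =>
    exists_perm_approx hM i.1 (Nat.one_div_pos_of_nat (α := ℝ) (n := i.2))
  classical
  let U : Ultrafilter I := Ultrafilter.of atTop
  have hU : (U : Filter I) ≤ atTop := Ultrafilter.of_le _
  have hmem : ∀ x, ∀ᶠ i : I in U, x ∈ i.1 := fun x =>
    hU (by filter_upwards [eventually_ge_atTop (({x}, 0) : I)] with i hi
           exact hi.1 (Finset.mem_singleton_self x))
  have hlim : Tendsto (fun i : I => 1 / ((i.2 : ℝ) + 1)) U (𝓝 0) :=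
    (tendsto_one_div_add_atTop_nhds_zero_nat.comp
      (tendsto_snd.mono_left prod_atTop_atTop_eq.ge)).mono_left hU
  let G : M.carrier → PermProduct U n := fun x i => g i x
  have hdist : ∀ x y, dist (G x) (G y) = dist x y := fun x y => by
    refine tendsto_nhds_unique (PermProduct.tendsto_dist (G x) (G y))
      (tendsto_iff_dist_tendsto_zero.2 (squeeze_zero' (.of_forall fun _ => dist_nonneg) ?_ hlim))
    filter_upwards [hmem x, hmem y] with i hx hy
    exact (hg1 i x hx y hy).le
  have hmul : ∀ x y, dist (G x * G y) (G (x * y)) = 0 := fun x y => by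
    refine tendsto_nhds_unique (PermProduct.tendsto_dist (G x * G y) (G (x * y)))
      (squeeze_zero' (.of_forall fun _ => permDist_nonneg _ _) ?_ hlim)
    filter_upwards [hmem x, hmem y, hmem (x * y)] with i hx hy hxy
    have h := hg2 i x hx y hy _ hxy
    rw [show M.func GroupFunc.mul ![x, y] = x * y from rfl, dist_self, sub_zero] at h
    exact (le_abs_self _).trans h.le
  let f : M.carrier →* MetricUltraproduct U n :=
    MonoidHom.mk' (fun x => SeparationQuotient.mk (G x)) fun x y => by
      rw [← SeparationQuotient.mk_mul, eq_comm, SeparationQuotient.mk_eq_mk]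
      exact Metric.inseparable_iff.2 (hmul x y)
  have hf : Isometry f := Isometry.of_dist_eq fun x y =>
    (SeparationQuotient.dist_mk _ _).trans (hdist x y)
  exact ⟨I, U, n, f, hn, hf, hf.isClosedEmbedding.isClosed_range⟩

end ContLogic

theorem mainTheorem11 :
    ContLogic.IsSupAxiomatizable.{u} (L := ContLogic.groupSignature)
      ContLogic.IsMetricSofic.{u} := by
  exact fun M => ⟨fun hM _ hσ => hσ.2 M hM, ContLogic.isMetricSofic_of_isModel⟩
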